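/- Let $G=(V,E)$ be a directed graph with finite edge set (parallel edges allowed), let $s\neq t$ be vertices, and let $k\ge 0$ be an integer. The agents are the edges, each edge $e$ has a cost $c_e\ge 0$, and a set $T\subseteq E$ is called feasible if it contains at least $k$ pairwise edge-disjoint $s$-$t$ paths. For a vector $x\in\mathbb{R}^E$ and $T\subseteq E$ write $x(T)=\sum_{e\in T}x_e$; for an $s$-$t$ path $P$, $x(P)$ is the sum over its edges. Let $S$ be a cheapest feasible set with respect to $c$ (ties broken arbitrarily); $S$ is the winning set. A bid vector $b\in\mathbb{R}^E$ is a Nash equilibrium if (i) $b_e\ge c_e$ for all $e\in E$; (ii) $b_e=c_e$ for all $e\notin S$; (iii) $b(S)\le b(T)$ for every feasible $T$; (iv) for every $e\in S$ there is a feasible $T$ with $e\notin T$ and $b(S)=b(T)$. Suppose that $G$ is a $(k+1)$-flow, i.e. $E$ is an inclusion-minimal edge set containing $k+1$ pairwise edge-disjoint $s$-$t$ paths. Let $M$ be the maximum of $c(P)$ over all $s$-$t$ paths $P$ in $G$. Then, for every bid vector $b$ with $b_e\ge c_e$ for all $e$, the vector $b$ is a Nash equilibrium if and only if $b(P)=M$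 for all $s$-$t$ paths $P$. Also, for every such $b$, $b$ is an optimal solution of the linear program "maximize $b(S)$ subject to (i), (ii), (iii)" if and only if $b(P)=M$ for all $s$-$t$ paths $P$. In particular, every Nash equilibrium $b$ satisfies $b(S)=k\cdot M$. -/

import Mathlib

/-- A directed graph with vertices `V` and edges `E`; parallel edges are allowed. -/
structure DirectedMultigraph (V E : Type*) where
  /-- the tail of an edge -/
  src : E → V
  /-- the head of an edge -/
  tgt : E → V

namespace DirectedMultigraph

variable {V E : Type*}

/-- `G.IsWalk u p v`: the edges in the list `p` form, in this order, a directed walk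
from `u` to `v`. -/
def IsWalk (G : DirectedMultigraph V E) : V → List E → V → Prop
  | u, [], v => u = v
  | u, e :: p, v => G.src e = u ∧ G.IsWalk (G.tgt e) p v

/-- A directed path from `u` to `v`: a directed walk that visits no vertex twice. -/
def IsPath (G : DirectedMultigraph V E) (u : V) (p : List E) (v : V) : Prop :=
  G.IsWalk u p v ∧ (u :: p.map G.tgt).Nodup

/-- The edge set `T` contains (at least) `m` pairwise edge-disjoint paths from `s` to `t`. -/
def HasDisjointPaths (G : DirectedMultigraph V E) (s t : V) (m : ℕ) (T : Finset E) : Prop :=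
  ∃ P : Fin m → List E,
    (∀ i, G.IsPath s (P i) t ∧ ∀ e ∈ P i, e ∈ T) ∧
      ∀ i j, i ≠ j → List.Disjoint (P i) (P j)

/-- The feasible sets of the `k`-flow set system: the edge sets that contain at least `k`
edge-disjoint paths from `s` to `t`. -/
def flowSets (G : DirectedMultigraph V E) (s t : V) (k : ℕ) : Set (Finset E) :=
  {T | G.HasDisjointPaths s t k T}

/-- `G` is an `m`-flow: its edge set is an inclusion-minimal set containing `m` edge-disjoint
paths from `s` to `t` (hence it is the union of the edge sets of `m` such paths). -/
def IsFlow [Fintype E] (G : DirectedMultigraph V E) (s t : V) (m : ℕ) : Prop :=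
  Minimal (G.HasDisjointPaths s t m) (Finset.univ : Finset E)

/-- The set of the total costs of the paths from `s` to `t`. -/
def pathCosts (G : DirectedMultigraph V E) (s t : V) (c : E → ℝ) : Set ℝ :=
  {x | ∃ p : List E, G.IsPath s p t ∧ (p.map c).sum = x}

/-- The maximum total cost of a path from `s` to `t`; see `isGreatest_maxPathCost`. -/
noncomputable def maxPathCost (G : DirectedMultigraph V E) (s t : V) (c : E → ℝ) : ℝ :=
  sSup (G.pathCosts s t c)

/-- If there is a path from `s` to `t`, the supremum is attained, so that
`maxPathCost` is a maximum. -/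
theorem isGreatest_maxPathCost [Fintype E] (G : DirectedMultigraph V E) (s t : V) (c : E → ℝ)
    (h : ∃ p, G.IsPath s p t) : IsGreatest (G.pathCosts s t c) (G.maxPathCost s t c) := by
  classical
  have hfin : (G.pathCosts s t c).Finite := by
    refine ((Set.finite_range
      (fun l : {l : List E // l.Nodup} => (l.1.map c).sum))).subset ?_
    rintro x ⟨p, hp, rfl⟩
    exact ⟨⟨p, (List.nodup_cons.1 hp.2).2.of_map⟩, rfl⟩
  obtain ⟨p, hp⟩ := h
  exact ⟨Set.Nonempty.csSup_mem ⟨_, p, hp, rfl⟩ hfin,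
    fun x hx => le_csSup hfin.bddAbove hx⟩

end DirectedMultigraph

/-- `S` is a cheapest feasible set with respect to the costs `c`
(under an arbitrary breaking of ties). -/
def IsCheapest {E : Type*} (F : Set (Finset E)) (c : E → ℝ) (S : Finset E) : Prop :=
  S ∈ F ∧ ∀ T ∈ F, ∑ e ∈ S, c e ≤ ∑ e ∈ T, c e

/-- The linear constraints on the bids `b` of a first-price auction on the set system `F` with
costs `c` and winning set `S`: individual rationality, losing agents bid their costs, and
`S` is a cheapest set with respect to the bids. -/
structure NashConstraints {E : Type*} (F : Set (Finset E)) (c : E → ℝ) (S : Finset E)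
    (b : E → ℝ) : Prop where
  rational : ∀ e, c e ≤ b e
  losers : ∀ e, e ∉ S → b e = c e
  wins : ∀ T ∈ F, ∑ e ∈ S, b e ≤ ∑ e ∈ T, b e

/-- Nash equilibrium: the constraints hold, and every winning agent `e` is kept from raising her
bid by a tight feasible set that avoids `e`. -/
structure IsNashEquilibrium {E : Type*} (F : Set (Finset E)) (c : E → ℝ) (S : Finset E)
    (b : E → ℝ) : Prop extends NashConstraints F c S b where
  tight : ∀ e ∈ S, ∃ T ∈ F, e ∉ T ∧ ∑ e' ∈ S, b e' = ∑ e' ∈ T, b e'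

/-- Buyer-pessimal Nash bids: an optimal solution of the linear program that maximizes the
total bid of `S` subject to the linear constraints. -/
structure IsBuyerPessimal {E : Type*} (F : Set (Finset E)) (c : E → ℝ) (S : Finset E)
    (b : E → ℝ) : Prop extends NashConstraints F c S b where
  maximal : ∀ b', NashConstraints F c S b' → ∑ e ∈ S, b' e ≤ ∑ e ∈ S, b e

/-! In a `(k + 1)`-flow the feasible sets are exactly the supersets of complements of `s`-`t` paths
(`hasDisjointPaths_compl`, `exists_compl_subset`), and the losing edges cost `M` in total
(`exists_losing_path`). As losers bid their costs, (iii) says that no path bids more than `M`, and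
(iv) that each winning edge lies on a path bidding exactly `M`; the losing edges share one such path
anyway. A flow is acyclic, so exchanging ends of paths forces all paths to bid `M`
(`path_eq_of_forall_mem_tight`).

For the linear program, any path extends to a partition of `E` into `k + 1` paths. Hence `b(S) =
b(E) - M ≤ k * M`, with equality exactly when every path bids `M`; longest-path potentials attain
this value (`exists_balanced`). -/

namespace DirectedMultigraph

/-! ### Walks, paths and flow values -/

section Walks

variable {V E : Type*} {G : DirectedMultigraph V E} {u v w s t : V} {p q : List E}

theorem isWalk_append :
    G.IsWalk u (p ++ q) v ↔ ∃ w, G.IsWalk u p w ∧ G.IsWalk w q v := by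
  induction p generalizing u with
  | nil => simp [IsWalk]
  | cons e p ih => simp [IsWalk, ih, and_assoc]

/-- A walk can be split at each of the vertices that it visits. -/
theorem IsWalk.exists_append (h : G.IsWalk u p v) (hw : w ∈ u :: p.map G.tgt) :
    ∃ p₁ p₂, p = p₁ ++ p₂ ∧ G.IsWalk u p₁ w ∧ G.IsWalk w p₂ v := by
  induction p generalizing u with
  | nil =>
    obtain rfl : w = u := by simpa using hw
    exact ⟨[], [], rfl, rfl, h⟩
  | cons e p ih =>
    rcases List.mem_cons.1 hw with rfl | hw
    · exact ⟨[], e :: p, rfl, rfl, h⟩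
    · obtain ⟨p₁, p₂, rfl, h₁, h₂⟩ := ih h.2 hw
      exact ⟨e :: p₁, p₂, rfl, ⟨h.1, h₁⟩, h₂⟩

/-- Potential differences telescope along a walk. -/
theorem IsWalk.sum_sub (h : G.IsWalk u p v) (f : V → ℝ) :
    (p.map fun e => f (G.tgt e) - f (G.src e)).sum = f v - f u := by
  induction p generalizing u with
  | nil =>
    obtain rfl : u = v := h
    simp
  | cons e p ih =>
    obtain ⟨rfl, h⟩ := h
    simp [ih h]

theorem IsPath.nodup (h : G.IsPath u p v) : p.Nodup :=
  (List.nodup_cons.1 h.2).2.of_map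

theorem IsPath.of_append (h : G.IsPath u (p ++ q) v) (hw : G.IsWalk u p w) : G.IsPath u p w :=
  ⟨hw, h.2.sublist (((List.sublist_append_left p q).map _).cons_cons _)⟩

theorem IsPath.eq_nil (h : G.IsPath u p u) : p = [] := by
  rcases p with _ | ⟨e, p⟩
  · rfl
  · exfalso
    have key : ∀ (x : V) (q : List E), G.IsWalk x q u → u ∈ x :: q.map G.tgt := by
      intro x q hq
      induction q generalizing x with
      | nil => exact List.mem_cons.2 (Or.inl (Eq.symm hq))
      | cons e q ih => exact List.mem_cons.2 (Or.inr (ih _ hq.2))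
    exact (List.nodup_cons.1 h.2).1 (key _ p h.1.2)

/-- The edge set `T`, with one unit on each edge, is an `s`-`t` flow of value `m`, expressed
through the potential differences of arbitrary vertex potentials. -/
def HasValue (G : DirectedMultigraph V E) (s t : V) (m : ℝ) (T : Finset E) : Prop :=
  ∀ f : V → ℝ, ∑ e ∈ T, (f (G.tgt e) - f (G.src e)) = m * (f t - f s)

/-- A flow of positive value contains a path from the source to the target. -/
theorem HasValue.exists_isPath {m : ℝ} {T : Finset E} (hT : G.HasValue s t m T) (hm : 0 < m) :
    ∃ p, G.IsPath s p t ∧ ∀ e ∈ p, e ∈ T := by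
  classical
  by_contra hno
  let R : V → Prop := fun v => ∃ p, G.IsPath s p v ∧ ∀ e ∈ p, e ∈ T
  have hs : R s := ⟨[], ⟨rfl, by simp⟩, by simp⟩
  have hclosed : ∀ e ∈ T, R (G.src e) → R (G.tgt e) := by
    rintro e he ⟨p, hp, hpT⟩
    by_cases hmem : G.tgt e ∈ s :: p.map G.tgt
    · obtain ⟨p₁, p₂, rfl, h₁, -⟩ := hp.1.exists_append hmem
      exact ⟨p₁, hp.of_append h₁, fun x hx => hpT x (List.mem_append_left _ hx)⟩
    · refine ⟨p ++ [e], ⟨isWalk_append.2 ⟨_, hp.1, rfl, rfl⟩, ?_⟩, ?_⟩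
      · rw [List.map_append, ← List.cons_append]
        exact List.nodup_append.2 ⟨hp.2, by simp, by
          rintro a ha b hb rfl
          exact hmem (List.mem_singleton.1 hb ▸ ha)⟩
      · intro x hx
        rcases List.mem_append.1 hx with hx | hx
        · exact hpT x hx
        · exact List.mem_singleton.1 hx ▸ he
  -- Cut argument: no edge of `T` leaves the reachable set, so its indicator gives a nonnegative
  -- sum, while the flow value makes it `-m`.
  have h := hT fun v => if R v then 1 else 0
  have ht : ¬ R t := hno
  have hnonneg : 0 ≤ ∑ e ∈ T, ((if R (G.tgt e) then (1 : ℝ) else 0) -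
      if R (G.src e) then 1 else 0) := by
    refine Finset.sum_nonneg fun e he => ?_
    by_cases h1 : R (G.src e)
    · simp [h1, hclosed e he h1]
    · simp only [h1, if_false]
      split_ifs <;> norm_num
  simp only [hs, ht, if_true, if_false] at h
  linarith

theorem HasValue.of_sum_paths {m : ℕ} {T : Finset E} {P : Fin m → List E} (hP : ∀ i, G.IsPath s (P i) t)
    (h : ∀ g : E → ℝ, ∑ e ∈ T, g e = ∑ i, ((P i).map g).sum) : G.HasValue s t m T := by
  intro f
  simp only [h, (hP _).1.sum_sub f, Finset.sum_const, Finset.card_univ, Fintype.card_fin,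
    nsmul_eq_mul]

theorem IsFlow.eq_univ [Fintype E] {m : ℕ} {T : Finset E} (hG : G.IsFlow s t m) (hT : G.HasDisjointPaths s t m T) :
    T = Finset.univ :=
  (Minimal.eq_of_ge hG hT (Finset.subset_univ T)).symm

end Walks

/-! ### Decomposition, acyclicity and path exchange in minimal flows -/

section Flows

variable {V E : Type*} [DecidableEq E] {G : DirectedMultigraph V E} {u v w s t : V}
  {p q : List E} {T : Finset E} {m : ℕ}

theorem IsWalk.hasValue_toFinset (h : G.IsWalk u p v) (hp : p.Nodup) :
    G.HasValue u v 1 p.toFinset := fun f => by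
  rw [List.sum_toFinset _ hp, h.sum_sub, one_mul]

theorem HasDisjointPaths.union_path (h : G.HasDisjointPaths s t m T) (hp : G.IsPath s p t)
    (hd : ∀ e ∈ p, e ∉ T) : G.HasDisjointPaths s t (m + 1) (T ∪ p.toFinset) := by
  obtain ⟨P, hP, hPd⟩ := h
  refine ⟨Fin.cons p P, Fin.cases ?_ fun i => ?_, Fin.cases ?_ fun i => ?_⟩
  · exact ⟨hp, fun e he => by simp_all⟩
  · refine ⟨by simpa using (hP i).1, fun e he => ?_⟩
    exact Finset.mem_union_left _ ((hP i).2 e (by simpa using he))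
  · refine Fin.cases (fun h => absurd rfl h) fun j _ => ?_
    exact fun e he he' => hd e he ((hP j).2 e he')
  · refine Fin.cases (fun _ => ?_) fun j hij => ?_
    · exact fun e he he' => hd e he' ((hP i).2 e he)
    · simpa using hPd i j (fun h => hij (by rw [h]))

/-- Disjoint paths in `T` have a union in `T` over which all sums split. -/
theorem HasDisjointPaths.exists_union (h : G.HasDisjointPaths s t m T) :
    ∃ T' ⊆ T, G.HasDisjointPaths s t m T' ∧
      ∃ P : Fin m → List E, (∀ i, G.IsPath s (P i) t) ∧ (∀ e ∈ T', ∃ i, e ∈ P i) ∧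
        ∀ g : E → ℝ, ∑ e ∈ T', g e = ∑ i, ((P i).map g).sum := by
  obtain ⟨P, hP, hd⟩ := h
  refine ⟨Finset.univ.biUnion fun i => (P i).toFinset, ?_, ⟨P, fun i => ⟨(hP i).1, ?_⟩, hd⟩,
    P, fun i => (hP i).1, ?_, fun g => ?_⟩
  · intro e he
    obtain ⟨i, -, he⟩ := Finset.mem_biUnion.1 he
    exact (hP i).2 e (by simpa using he)
  · intro e he
    exact Finset.mem_biUnion.2 ⟨i, Finset.mem_univ _, by simpa using he⟩
  · intro e he
    obtain ⟨i, -, he⟩ := Finset.mem_biUnion.1 he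
    exact ⟨i, by simpa using he⟩
  · rw [Finset.sum_biUnion]
    · exact Finset.sum_congr rfl fun i _ => List.sum_toFinset _ (hP i).1.nodup
    · intro i _ j _ hij
      exact List.disjoint_toFinset_iff_disjoint.2 (hd i j hij)

theorem HasValue.sdiff {a b : ℝ} {T' : Finset E} (hT : G.HasValue s t a T)
    (hT' : G.HasValue s t b T') (hsub : T' ⊆ T) : G.HasValue s t (a - b) (T \ T') := by
  intro f
  have h := Finset.sum_sdiff hsub (f := fun e => f (G.tgt e) - f (G.src e))
  rw [hT f, hT' f] at h
  linarith

/-- Flow decomposition: a flow of integral value `m` contains `m` disjoint paths. -/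
theorem HasValue.hasDisjointPaths (h : G.HasValue s t m T) : G.HasDisjointPaths s t m T := by
  induction m generalizing T with
  | zero => exact ⟨Fin.elim0, fun i => i.elim0, fun i => i.elim0⟩
  | succ m ih =>
    obtain ⟨p, hp, hpT⟩ := h.exists_isPath (by positivity)
    have hsub : p.toFinset ⊆ T := fun e he => hpT e (by simpa using he)
    have h' := h.sdiff (hp.1.hasValue_toFinset hp.nodup) hsub
    have h'' : G.HasValue s t m (T \ p.toFinset) := by simpa using h'
    have := (ih h'').union_path hp fun e he => by simp [he]
    rwa [Finset.sdiff_union_of_subset hsub] at this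

variable [Fintype E]

theorem IsFlow.exists_paths (hG : G.IsFlow s t m) :
    ∃ P : Fin m → List E, (∀ i, G.IsPath s (P i) t) ∧ (∀ e, ∃ i, e ∈ P i) ∧
      ∀ g : E → ℝ, ∑ e, g e = ∑ i, ((P i).map g).sum := by
  obtain ⟨T, -, hT, P, hP, hmem, hsum⟩ := HasDisjointPaths.exists_union hG.prop
  obtain rfl := hG.eq_univ hT
  exact ⟨P, hP, fun e => hmem e (Finset.mem_univ e), hsum⟩

theorem IsFlow.hasValue (hG : G.IsFlow s t m) : G.HasValue s t m Finset.univ := by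
  obtain ⟨P, hP, -, hsum⟩ := hG.exists_paths
  exact .of_sum_paths hP hsum

theorem IsFlow.exists_isPath_mem (hG : G.IsFlow s t m) (e : E) :
    ∃ p, G.IsPath s p t ∧ e ∈ p := by
  obtain ⟨P, hP, hmem, -⟩ := hG.exists_paths
  obtain ⟨i, hi⟩ := hmem e
  exact ⟨P i, hP i, hi⟩

theorem IsFlow.exists_isPath_src (hG : G.IsFlow s t m) (e : E) :
    ∃ p, G.IsPath s p (G.src e) := by
  obtain ⟨p, hp, he⟩ := hG.exists_isPath_mem e
  obtain ⟨p₁, p₂, rfl⟩ := List.append_of_mem he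
  obtain ⟨w, h₁, rfl, -⟩ := isWalk_append.1 hp.1
  exact ⟨p₁, hp.of_append h₁⟩

/-- By minimality a flow contains no cycle. -/
theorem IsFlow.eq_nil_of_closed (hG : G.IsFlow s t m) (hp : G.IsWalk u p u) (hn : p.Nodup) :
    p = [] := by
  -- A closed walk carries value `0`, so deleting it keeps the value `m`, against minimality unless
  -- it is empty.
  have h : G.HasValue s t m (Finset.univ \ p.toFinset) := by
    have h0 : G.HasValue s t 0 p.toFinset := fun f => by
      have := hp.hasValue_toFinset hn f
      simp_all
    simpa using hG.hasValue.sdiff h0 (Finset.subset_univ _)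
  have h' := hG.eq_univ h.hasDisjointPaths
  refine List.eq_nil_iff_forall_not_mem.2 fun e he => ?_
  have := h' ▸ Finset.mem_univ e
  simp [he] at this

/-- In a flow every walk is a path. -/
theorem IsFlow.isPath (hG : G.IsFlow s t m) (hp : G.IsWalk u p v) : G.IsPath u p v := by
  refine ⟨hp, ?_⟩
  induction p generalizing u with
  | nil => simp
  | cons e p ih =>
    have hn := ih hp.2
    refine List.nodup_cons.2 ⟨fun hu => ?_, hn⟩
    -- A return to `u` would close a nonempty cycle; its edges are distinct because their heads are.
    obtain ⟨p₁, p₂, rfl, h₁, -⟩ := hp.2.exists_append hu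
    have hn₁ : (G.tgt e :: p₁.map G.tgt).Nodup :=
      hn.sublist (((List.sublist_append_left p₁ p₂).map _).cons_cons _)
    have hnodup : (e :: p₁).Nodup := List.Nodup.of_map G.tgt hn₁
    exact List.cons_ne_nil _ _ (hG.eq_nil_of_closed (u := u) (p := e :: p₁) ⟨hp.1, h₁⟩ hnodup)

/-- The complement of a path in an `(m + 1)`-flow contains `m` disjoint paths. -/
theorem IsFlow.hasDisjointPaths_compl (hG : G.IsFlow s t (m + 1)) (hp : G.IsPath s p t) :
    G.HasDisjointPaths s t m (p.toFinset)ᶜ := by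
  refine HasValue.hasDisjointPaths ?_
  have := hG.hasValue.sdiff (hp.1.hasValue_toFinset hp.nodup) (Finset.subset_univ _)
  rw [Finset.compl_eq_univ_sdiff]
  simpa using this

/-- If `T` contains `m` disjoint paths of an `(m + 1)`-flow, then `T` contains the complement
of a path. -/
theorem IsFlow.exists_compl_subset (hG : G.IsFlow s t (m + 1))
    (hT : G.HasDisjointPaths s t m T) :
    ∃ p, G.IsPath s p t ∧ (p.toFinset)ᶜ ⊆ T := by
  obtain ⟨T', hsub, hT', P, hP, -, hsum⟩ := hT.exists_union
  -- What remains has value `1` and so contains a path; with `T'` it makes `m + 1` disjoint paths,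
  -- which by minimality exhaust all edges.
  have hval := hG.hasValue.sdiff (.of_sum_paths hP hsum) (Finset.subset_univ _)
  obtain ⟨p, hp, hd⟩ := hval.exists_isPath (by simp)
  have huniv := hG.eq_univ (hT'.union_path hp fun e he => by simpa using hd e he)
  refine ⟨p, hp, fun e he => hsub ?_⟩
  rcases Finset.mem_union.1 (huniv ▸ Finset.mem_univ e) with h | h
  · exact h
  · exact absurd h (Finset.mem_compl.1 he)

theorem sum_compl_path (hp : p.Nodup) (b : E → ℝ) :
    ∑ e ∈ (p.toFinset)ᶜ, b e = ∑ e, b e - (p.map b).sum := by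
  rw [← Finset.sum_add_sum_compl p.toFinset b, List.sum_toFinset _ hp]
  ring

/-- If all paths of an `(m + 1)`-flow cost at most `M`, then the total cost exceeds the cost of
any one path by at most `m * M`. -/
theorem IsFlow.sum_le_of_path_le (hG : G.IsFlow s t (m + 1)) {b : E → ℝ} {M : ℝ}
    (hb : ∀ q, G.IsPath s q t → (q.map b).sum ≤ M) (hp : G.IsPath s p t) :
    ∑ e, b e ≤ (p.map b).sum + m * M := by
  obtain ⟨T, hsub, hT, P, hP, -, hsum⟩ := (hG.hasDisjointPaths_compl hp).exists_union
  have hd : ∀ e ∈ p, e ∉ T := fun e he h => by simpa [he] using hsub h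
  have huniv := hG.eq_univ (hT.union_path hp hd)
  rw [← huniv, Finset.sum_union (Finset.disjoint_right.2 fun e he => hd e (by simpa using he)),
    hsum, List.sum_toFinset _ hp.nodup, add_comm]
  gcongr
  calc ∑ i, ((P i).map b).sum ≤ ∑ _i : Fin m, M := Finset.sum_le_sum fun i _ => hb _ (hP i)
    _ = m * M := by simp

theorem IsFlow.sum_eq_of_path_eq (hG : G.IsFlow s t m) {b : E → ℝ} {M : ℝ}
    (hb : ∀ q, G.IsPath s q t → (q.map b).sum = M) : ∑ e, b e = m * M := by
  obtain ⟨P, hP, -, hsum⟩ := hG.exists_paths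
  rw [hsum, Finset.sum_congr rfl fun i _ => hb _ (hP i)]
  simp

/-- If every edge of a flow lies on a longest path, then all paths are longest. -/
theorem IsFlow.path_eq_of_forall_mem_tight (hG : G.IsFlow s t m) {b : E → ℝ} {M : ℝ}
    (hle : ∀ q, G.IsPath s q t → (q.map b).sum ≤ M)
    (htight : ∀ e, ∃ q, G.IsPath s q t ∧ e ∈ q ∧ (q.map b).sum = M)
    (hne : ∃ q, G.IsPath s q t ∧ (q.map b).sum = M) (hp : G.IsPath s p t) :
    (p.map b).sum = M := by
  -- Every walk from `s` can be completed to one of total exactly `M`.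
  have key : ∀ (r : List E) (v : V), G.IsWalk s r v →
      ∃ q, G.IsWalk v q t ∧ (r.map b).sum + (q.map b).sum = M := by
    intro r
    induction r using List.reverseRecOn with
    | nil =>
      rintro v rfl
      obtain ⟨q, hq, h⟩ := hne
      exact ⟨q, hq.1, by simpa using h⟩
    | append_singleton r e ih =>
      intro v hr
      obtain ⟨w, hr₁, rfl, rfl⟩ := isWalk_append.1 hr
      obtain ⟨q, hq, hqM⟩ := ih _ hr₁
      obtain ⟨l, hl, he, hlM⟩ := htight e
      obtain ⟨l₁, l₂, rfl⟩ := List.append_of_mem he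
      obtain ⟨w, h₁, rfl, h₂⟩ := isWalk_append.1 hl.1
      -- Swapping the ends of two walks of total `M` at the tail of `e` preserves the sum `2 * M`.
      -- Both new walks are paths, hence at most `M`, so both equal `M`.
      have ha := hle _ (hG.isPath (isWalk_append.2 ⟨_, h₁, hq⟩))
      have hb := hle _ (hG.isPath (p := r ++ e :: l₂) (isWalk_append.2 ⟨_, hr₁, rfl, h₂⟩))
      refine ⟨l₂, h₂, ?_⟩
      simp only [List.map_append, List.map_cons, List.map_nil, List.sum_append, List.sum_cons,
        List.sum_nil] at *
      linarith
  obtain ⟨q, hq, h⟩ := key p t hp.1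
  have := (hG.isPath hq).eq_nil
  simpa [this] using h

/-- The costs of a flow can be raised so that all paths become as expensive as the most
expensive one. -/
theorem IsFlow.exists_balanced (hG : G.IsFlow s t m) (c : E → ℝ) :
    ∃ b : E → ℝ, (∀ e, c e ≤ b e) ∧
      ∀ p, G.IsPath s p t → (p.map b).sum = G.maxPathCost s t c := by
  -- Differences of longest-path distances from `s`: acyclicity lets a longest path to the tail be
  -- extended by `e`, and sums over paths telescope.
  refine ⟨fun e => G.maxPathCost s (G.tgt e) c - G.maxPathCost s (G.src e) c, fun e => ?_,
    fun p hp => ?_⟩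
  · have hsrc := hG.exists_isPath_src e
    obtain ⟨q, hq, hqc⟩ := (G.isGreatest_maxPathCost s (G.src e) c hsrc).1
    have hqe : G.IsPath s (q ++ [e]) (G.tgt e) :=
      hG.isPath (isWalk_append.2 ⟨_, hq.1, rfl, rfl⟩)
    have := (G.isGreatest_maxPathCost s (G.tgt e) c ⟨_, hqe⟩).2 ⟨_, hqe, rfl⟩
    simp only [List.map_append, List.map_cons, List.map_nil, List.sum_append, List.sum_cons,
      List.sum_nil] at this
    linarith
  · rw [hp.1.sum_sub fun v => G.maxPathCost s v c]
    obtain ⟨q, hq, hqc⟩ :=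
      (G.isGreatest_maxPathCost s s c ⟨[], rfl, by simp⟩).1
    rw [hq.eq_nil] at hqc
    rw [← hqc]
    simp

end Flows

/-! ### Equilibria and the linear program -/

section Auction

variable {V E : Type*} [DecidableEq E] [Fintype E] {G : DirectedMultigraph V E} {s t : V} {k : ℕ}
  {c b : E → ℝ} {S : Finset E}

/-- The winning set contains the complement of a most expensive path, and the further winning
edges cost nothing. -/
theorem IsFlow.exists_losing_path (hG : G.IsFlow s t (k + 1)) (hc : ∀ e, 0 ≤ c e)
    (hS : IsCheapest (G.flowSets s t k) c S) :
    ∃ p, G.IsPath s p t ∧ (p.toFinset)ᶜ ⊆ S ∧ (p.map c).sum = G.maxPathCost s t c ∧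
      ∑ e ∈ Sᶜ, c e = G.maxPathCost s t c := by
  obtain ⟨p, hp, hsub⟩ := hG.exists_compl_subset hS.1
  obtain ⟨⟨q, hq, hqc⟩, hmax⟩ := G.isGreatest_maxPathCost s t c ⟨p, hp⟩
  -- The chain `c(E) - M ≤ c(E) - c(p) ≤ c(S) ≤ c(E) - M` collapses to equalities.
  have h₁ := hmax ⟨p, hp, rfl⟩
  have h₂ := hS.2 _ (hG.hasDisjointPaths_compl hq)
  have h₃ := Finset.sum_le_sum_of_subset_of_nonneg hsub fun e _ _ => hc e
  rw [sum_compl_path hq.nodup] at h₂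
  rw [sum_compl_path hp.nodup] at h₃
  have h₄ := Finset.sum_add_sum_compl S c
  exact ⟨p, hp, hsub, by linarith, by linarith⟩

theorem _root_.NashConstraints.sum_add (h : NashConstraints (G.flowSets s t k) c S b)
    (hG : G.IsFlow s t (k + 1)) (hc : ∀ e, 0 ≤ c e)
    (hS : IsCheapest (G.flowSets s t k) c S) :
    ∑ e ∈ S, b e + G.maxPathCost s t c = ∑ e, b e := by
  obtain ⟨-, -, -, -, hM⟩ := hG.exists_losing_path hc hS
  rw [← Finset.sum_add_sum_compl S b, ← hM]
  congr 1
  exact Finset.sum_congr rfl fun e he => (h.losers e (Finset.mem_compl.1 he)).symm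

/-- The complement of the path is feasible, so it bids at least `b(S) = b(E) - M`. -/
theorem _root_.NashConstraints.path_le (h : NashConstraints (G.flowSets s t k) c S b)
    (hG : G.IsFlow s t (k + 1)) (hc : ∀ e, 0 ≤ c e)
    (hS : IsCheapest (G.flowSets s t k) c S) {p : List E} (hp : G.IsPath s p t) :
    (p.map b).sum ≤ G.maxPathCost s t c := by
  have h₁ := h.wins _ (hG.hasDisjointPaths_compl hp)
  rw [sum_compl_path hp.nodup] at h₁
  linarith [h.sum_add hG hc hS]

/-- A tight feasible set contains the complement of a path of maximum total bid. -/
theorem _root_.NashConstraints.exists_path_of_tight (h : NashConstraints (G.flowSets s t k) c S b)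
    (hG : G.IsFlow s t (k + 1)) (hc : ∀ e, 0 ≤ c e)
    (hS : IsCheapest (G.flowSets s t k) c S) {T : Finset E} (hT : T ∈ G.flowSets s t k)
    (hTS : ∑ e ∈ S, b e = ∑ e ∈ T, b e) :
    ∃ p, G.IsPath s p t ∧ (p.toFinset)ᶜ ⊆ T ∧ (p.map b).sum = G.maxPathCost s t c := by
  obtain ⟨p, hp, hsub⟩ := hG.exists_compl_subset hT
  refine ⟨p, hp, hsub, le_antisymm (h.path_le hG hc hS hp) ?_⟩
  have h₁ := Finset.sum_le_sum_of_subset_of_nonneg hsub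
    fun e _ _ => (hc e).trans (h.rational e)
  rw [sum_compl_path hp.nodup] at h₁
  linarith [h.sum_add hG hc hS]

theorem nashConstraints_of_path_eq (hG : G.IsFlow s t (k + 1)) (hc : ∀ e, 0 ≤ c e)
    (hS : IsCheapest (G.flowSets s t k) c S) (hcb : ∀ e, c e ≤ b e)
    (hb : ∀ p, G.IsPath s p t → (p.map b).sum = G.maxPathCost s t c) :
    NashConstraints (G.flowSets s t k) c S b := by
  obtain ⟨p, hp, hsub, hpM, hM⟩ := hG.exists_losing_path hc hS
  -- The path `p` already costs `M`, so no bid on it can be raised; all losing edges lie on `p`.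
  have heq : ∀ e ∈ p.toFinset, c e = b e := by
    refine (Finset.sum_eq_sum_iff_of_le fun e _ => hcb e).1 ?_
    rw [List.sum_toFinset _ hp.nodup, List.sum_toFinset _ hp.nodup, hpM, hb p hp]
  have hlose : ∀ e, e ∉ S → b e = c e := fun e he => by
    refine (heq e ?_).symm
    by_contra h
    exact he (hsub (Finset.mem_compl.2 h))
  refine ⟨hcb, hlose, fun T hT => ?_⟩
  obtain ⟨q, hq, hqT⟩ := hG.exists_compl_subset hT
  have h₁ := Finset.sum_le_sum_of_subset_of_nonneg hqT fun e _ _ => (hc e).trans (hcb e)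
  rw [sum_compl_path hq.nodup, hb q hq] at h₁
  have h₂ : ∑ e ∈ Sᶜ, b e = ∑ e ∈ Sᶜ, c e :=
    Finset.sum_congr rfl fun e he => hlose e (Finset.mem_compl.1 he)
  linarith [Finset.sum_add_sum_compl S b]

theorem isNashEquilibrium_iff (hG : G.IsFlow s t (k + 1)) (hc : ∀ e, 0 ≤ c e)
    (hS : IsCheapest (G.flowSets s t k) c S) (hcb : ∀ e, c e ≤ b e) :
    IsNashEquilibrium (G.flowSets s t k) c S b ↔
      ∀ p, G.IsPath s p t → (p.map b).sum = G.maxPathCost s t c := by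
  constructor
  · intro h p hp
    have hn := h.toNashConstraints
    -- `S` is tight against itself, which yields a path of bid `M` through all losing edges.
    obtain ⟨q, hq, hqS, hqM⟩ := hn.exists_path_of_tight hG hc hS hS.1 rfl
    refine hG.path_eq_of_forall_mem_tight (fun r hr => hn.path_le hG hc hS hr) (fun e => ?_)
      ⟨q, hq, hqM⟩ hp
    by_cases he : e ∈ S
    · obtain ⟨T, hT, heT, htight⟩ := h.tight e he
      obtain ⟨r, hr, hrT, hrM⟩ := hn.exists_path_of_tight hG hc hS hT htight
      refine ⟨r, hr, ?_, hrM⟩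
      by_contra her
      exact heT (hrT (by simpa using her))
    · refine ⟨q, hq, ?_, hqM⟩
      by_contra heq
      exact he (hqS (by simpa using heq))
  · intro hb
    have hn := nashConstraints_of_path_eq hG hc hS hcb hb
    refine ⟨hn, fun e _ => ?_⟩
    obtain ⟨p, hp, he⟩ := hG.exists_isPath_mem e
    refine ⟨_, hG.hasDisjointPaths_compl hp, by simpa using he, ?_⟩
    rw [sum_compl_path hp.nodup, hb p hp]
    linarith [hn.sum_add hG hc hS]

theorem _root_.NashConstraints.sum_eq_of_path_eq (h : NashConstraints (G.flowSets s t k) c S b)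
    (hG : G.IsFlow s t (k + 1)) (hc : ∀ e, 0 ≤ c e)
    (hS : IsCheapest (G.flowSets s t k) c S)
    (hb : ∀ p, G.IsPath s p t → (p.map b).sum = G.maxPathCost s t c) :
    ∑ e ∈ S, b e = k * G.maxPathCost s t c := by
  have h₁ := hG.sum_eq_of_path_eq hb
  have h₂ := h.sum_add hG hc hS
  push_cast at h₁
  linarith

theorem isBuyerPessimal_iff (hG : G.IsFlow s t (k + 1)) (hc : ∀ e, 0 ≤ c e)
    (hS : IsCheapest (G.flowSets s t k) c S) (hcb : ∀ e, c e ≤ b e) :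
    IsBuyerPessimal (G.flowSets s t k) c S b ↔
      ∀ p, G.IsPath s p t → (p.map b).sum = G.maxPathCost s t c := by
  constructor
  · intro h p hp
    have hn := h.toNashConstraints
    obtain ⟨b', hcb', hb'⟩ := hG.exists_balanced c
    have hn' := nashConstraints_of_path_eq hG hc hS hcb' hb'
    have h₁ := h.maximal b' hn'
    rw [hn'.sum_eq_of_path_eq hG hc hS hb'] at h₁
    -- The balanced bids give `b(S) ≥ k * M`, hence `b(E) ≥ (k + 1) * M`. The `k` paths
    -- complementing `p` bid at most `k * M`, which leaves at least `M` for `p`.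
    have h₂ := hG.sum_le_of_path_le (fun q hq => hn.path_le hG hc hS hq) hp
    exact le_antisymm (hn.path_le hG hc hS hp) (by linarith [hn.sum_add hG hc hS])
  · intro hb
    have hn := nashConstraints_of_path_eq hG hc hS hcb hb
    refine ⟨hn, fun b' hn' => ?_⟩
    obtain ⟨p, hp, -⟩ := hG.exists_losing_path hc hS
    have h₁ := hG.sum_le_of_path_le (fun q hq => hn'.path_le hG hc hS hq) hp
    rw [hn.sum_eq_of_path_eq hG hc hS hb]
    linarith [hn'.sum_add hG hc hS, hn'.path_le hG hc hS hp]

end Auction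

end DirectedMultigraph

theorem mainTheorem8 {V E : Type*} [Fintype E] (G : DirectedMultigraph V E) (s t : V)
    (hst : s ≠ t) (k : ℕ) (hG : G.IsFlow s t (k + 1)) (c : E → ℝ) (hc : ∀ e, 0 ≤ c e)
    (S : Finset E) (hS : IsCheapest (G.flowSets s t k) c S) :
    (∀ b : E → ℝ, (∀ e, c e ≤ b e) →
      (IsNashEquilibrium (G.flowSets s t k) c S b ↔
        ∀ P : List E, G.IsPath s P t → (P.map b).sum = G.maxPathCost s t c)) ∧
    (∀ b : E → ℝ, (∀ e, c e ≤ b e) →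
      (IsBuyerPessimal (G.flowSets s t k) c S b ↔
        ∀ P : List E, G.IsPath s P t → (P.map b).sum = G.maxPathCost s t c)) ∧
    (∀ b : E → ℝ, IsNashEquilibrium (G.flowSets s t k) c S b →
      ∑ e ∈ S, b e = k * G.maxPathCost s t c) := by
  classical
  refine ⟨fun b hcb => DirectedMultigraph.isNashEquilibrium_iff hG hc hS hcb,
    fun b hcb => DirectedMultigraph.isBuyerPessimal_iff hG hc hS hcb, fun b h => ?_⟩
  exact h.toNashConstraints.sum_eq_of_path_eq hG hc hS
    ((DirectedMultigraph.isNashEquilibrium_iff hG hc hS h.rational).1 h)
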